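/- Consider the following random graph process. Start with a single vertex and no edges. At step $n\ge 1$, choose two (not necessarily different) vertices $u,v$ among the $n$ existing ones, independently of each other and of all previous choices, each uniformly at random. Add a new vertex and connect it to $u$ and to all neighbours of $u$. Then delete all edges incident to $v$, except that an edge incident to the new vertex is not deleted (version 1 of the duplication--deletion model). Let $X[n,d]$ be the number of vertices of degree $d$ after $n$ steps, when the graph has $n+1$ vertices. Then there is a (deterministic) sequence $(c_d)_{d\ge 0}$ of positive numbers satisfying \[ c_0=\frac{1+c_1}{3},\qquad c_d=\frac{d+1}{2d+3}\bigl(c_{d-1}+c_{d+1}\bigr)\quad (d\ge 1), \] such that for every $d\ge 0$ \[ \frac{X[n,d]}{n+1}\longrightarrow c_d\qquad\text{almost surely as } n\to\infty . \] -/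

import Mathlib

open MeasureTheory ProbabilityTheory Filter Topology

namespace DuplicationDeletion

/-- Duplication: the vertices of `G` are `0, …, m - 1`; the new vertex `m` (`Fin.last m`) is
joined to the old vertex `u` and to all neighbours of `u`. -/
def duplicate {m : ℕ} (G : SimpleGraph (Fin m)) (u : Fin m) : SimpleGraph (Fin (m + 1)) :=
  G.map Fin.castSuccEmb ⊔
    SimpleGraph.fromRel fun x y =>
      x = Fin.last m ∧ ∃ i : Fin m, y = i.castSucc ∧ (i = u ∨ G.Adj u i)

/-- Erasure with protection of the new edges: all edges at the old vertex `v` are deleted, except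
for those that end in the new vertex `m` (`Fin.last m`). -/
def eraseProtected {m : ℕ} (H : SimpleGraph (Fin (m + 1))) (v : Fin m) :
    SimpleGraph (Fin (m + 1)) :=
  H.deleteEdges {e : Sym2 (Fin (m + 1)) | v.castSucc ∈ e ∧ Fin.last m ∉ e}

/-- The graph after `n` steps (version with protected new edges). It starts with a single vertex;
in step `n + 1` the old vertex `u n` is duplicated, and then the edges of the old vertex `v n`
are erased. -/
def graph (u v : (n : ℕ) → Fin (n + 1)) : (n : ℕ) → SimpleGraph (Fin (n + 1))
  | 0 => ⊥
  | n + 1 => eraseProtected (duplicate (graph u v n) (u n)) (v n)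

open Classical in
/-- The number of vertices of degree `d`. -/
noncomputable def degreeCount {m : ℕ} (G : SimpleGraph (Fin m)) (d : ℕ) : ℕ :=
  (Finset.univ.filter fun x : Fin m => G.degree x = d).card

/-- In every step two old vertices are chosen uniformly at random, independently of each other,
and independently over the steps. `U n` and `V n` are the choices of step `n + 1`, when there are
`n + 1` old vertices. -/
structure IsRandomChoice {Ω : Type*} [MeasurableSpace Ω] (μ : Measure Ω)
    (U V : (n : ℕ) → Ω → Fin (n + 1)) : Prop where
  measurable_fst : ∀ n, Measurable (U n)
  measurable_snd : ∀ n, Measurable (V n)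
  uniform_fst : ∀ (n : ℕ) (a : Fin (n + 1)), μ (U n ⁻¹' {a}) = ((n : ENNReal) + 1)⁻¹
  uniform_snd : ∀ (n : ℕ) (a : Fin (n + 1)), μ (V n ⁻¹' {a}) = ((n : ENNReal) + 1)⁻¹
  indep_within_step : ∀ n, IndepFun (U n) (V n) μ
  indep_steps : iIndepFun (fun (n : ℕ) (ω : Ω) => (U n ω, V n ω)) μ

/-- `X[n, d]`: the number of vertices of degree `d` after `n` steps, as a random variable. -/
noncomputable def X {Ω : Type*} (U V : (n : ℕ) → Ω → Fin (n + 1)) (n d : ℕ) (ω : Ω) : ℕ :=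
  degreeCount (graph (fun k => U k ω) (fun k => V k ω) n) d

end DuplicationDeletion

/-!
Given the graph after `n` steps, with `m = n + 1` vertices, the expected change in the number `N d`
of vertices of degree `d` is `(d + 1) * (N (d - 1) + N (d + 1) - 2 * N d) / m`, with `N (-1) = m`,
up to an error of order `1 / m + (sum of degrees) / m ^ 2`. The sum of the squares of the degrees
grows linearly in expectation. Hence that error tends to `0` almost surely, and the martingale
differences `N d (n + 1) - E[N d (n + 1) | past]` have bounded second moments, so that their
averages tend to `0` almost surely. Therefore the deviations of the densities `N d / m` from a
bounded solution `c` of the stationary equation satisfy a linear recursion with negligible noise.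
It forces the `limsup`s of their absolute values to be convex in `d`; being bounded and starting at
`0`, they vanish. A positive bounded solution is
`c d = ∫ y in (0, ∞), (y / (1 + y)) ^ (d + 1) * exp (-y)`.
-/

namespace DuplicationDeletion

/-! ### The limiting degree distribution -/

/-- The density `(y / (1 + y)) ^ j * exp (-y)` on `(0, ∞)`, whose total mass is the limiting
proportion of the vertices of degree `j - 1` if `j > 0`, and `1` if `j = 0`. -/
noncomputable def stationaryDensity (j : ℕ) (y : ℝ) : ℝ := (y / (1 + y)) ^ j * Real.exp (-y)

/-- The limiting degree distribution, with the index shifted by one so that the recursion for the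
proportion of isolated vertices takes the same form as the others, with boundary value `1` at
index `0`. -/
noncomputable def stationary (j : ℕ) : ℝ := ∫ y in Set.Ioi 0, stationaryDensity j y

lemma stationaryDensity_pos (j : ℕ) {y : ℝ} (hy : 0 < y) : 0 < stationaryDensity j y := by
  unfold stationaryDensity
  positivity

lemma stationaryDensity_le_exp_neg (j : ℕ) {y : ℝ} (hy : 0 < y) :
    stationaryDensity j y ≤ Real.exp (-y) :=
  mul_le_of_le_one_left (Real.exp_pos _).le
    (pow_le_one₀ (by positivity) ((div_le_one (by positivity)).2 (by linarith)))

lemma integrableOn_stationaryDensity (j : ℕ) :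
    IntegrableOn (stationaryDensity j) (Set.Ioi 0) := by
  refine (integrableOn_exp_neg_Ioi 0).mono' ?_ ?_
  · unfold stationaryDensity
    exact Measurable.aestronglyMeasurable (by fun_prop)
  · filter_upwards [ae_restrict_mem measurableSet_Ioi] with y hy
    rw [Real.norm_of_nonneg (stationaryDensity_pos j hy).le]
    exact stationaryDensity_le_exp_neg j hy

lemma stationary_zero : stationary 0 = 1 := by
  simpa only [stationary, stationaryDensity, pow_zero, one_mul] using integral_exp_neg_Ioi_zero

lemma stationary_pos (j : ℕ) : 0 < stationary j := by
  rw [stationary, setIntegral_pos_iff_support_of_nonneg_ae _ (integrableOn_stationaryDensity j)]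
  · have : Set.Ioi (0 : ℝ) ⊆ Function.support (stationaryDensity j) :=
      fun y hy => (stationaryDensity_pos j hy).ne'
    simp [Set.inter_eq_right.2 this]
  · filter_upwards [ae_restrict_mem measurableSet_Ioi] with y hy
    exact (stationaryDensity_pos j hy).le

lemma stationary_le_one (j : ℕ) : stationary j ≤ 1 := by
  rw [← integral_exp_neg_Ioi_zero]
  exact setIntegral_mono_on (integrableOn_stationaryDensity j) (integrableOn_exp_neg_Ioi 0)
    measurableSet_Ioi fun y hy => stationaryDensity_le_exp_neg j hy

lemma tendsto_stationaryDensity_atTop (j : ℕ) :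
    Tendsto (stationaryDensity j) atTop (𝓝 0) := by
  refine squeeze_zero' ?_ ?_ (Real.tendsto_exp_neg_atTop_nhds_zero)
  · filter_upwards [eventually_gt_atTop 0] with y hy using (stationaryDensity_pos j hy).le
  · filter_upwards [eventually_gt_atTop 0] with y hy using stationaryDensity_le_exp_neg j hy

lemma hasDerivAt_stationaryDensity_succ (d : ℕ) {y : ℝ} (hy : 0 ≤ y) :
    HasDerivAt (stationaryDensity (d + 1))
      ((d + 1) * (stationaryDensity d y - 2 * stationaryDensity (d + 1) y
        + stationaryDensity (d + 2) y) - stationaryDensity (d + 1) y) y := by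
  have hy1 : 1 + y ≠ 0 := by positivity
  have hquot : HasDerivAt (fun y : ℝ => y / (1 + y)) ((1 - y / (1 + y)) ^ 2) y := by
    refine ((hasDerivAt_id' y).div ((hasDerivAt_id' y).const_add 1) hy1).congr_deriv ?_
    field_simp
    ring
  refine ((hquot.pow (d + 1)).mul (hasDerivAt_neg y).exp).congr_deriv ?_
  simp only [stationaryDensity, Nat.add_sub_cancel, Pi.pow_apply]
  push_cast
  ring

/-- Integrating the derivative of `stationaryDensity (d + 1)` over `(0, ∞)` gives `0`. -/
lemma stationary_succ (d : ℕ) :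
    stationary (d + 1)
      = ((d : ℝ) + 1) / (2 * d + 3) * (stationary d + stationary (d + 2)) := by
  have hd := integrableOn_stationaryDensity d
  have hd1 := integrableOn_stationaryDensity (d + 1)
  have hd2 := integrableOn_stationaryDensity (d + 2)
  have hdiff : IntegrableOn (fun y => stationaryDensity d y - 2 * stationaryDensity (d + 1) y)
      (Set.Ioi 0) := hd.sub (hd1.const_mul 2)
  have hsum : IntegrableOn (fun y => (d + 1) * (stationaryDensity d y
      - 2 * stationaryDensity (d + 1) y + stationaryDensity (d + 2) y)) (Set.Ioi 0) :=
    (hdiff.add hd2).const_mul _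
  have h := integral_Ioi_of_hasDerivAt_of_tendsto'
    (fun y hy => hasDerivAt_stationaryDensity_succ d hy) (hsum.sub hd1)
    (tendsto_stationaryDensity_atTop (d + 1))
  have hzero : stationaryDensity (d + 1) 0 = 0 := by simp [stationaryDensity]
  rw [integral_sub hsum hd1, integral_const_mul, integral_add hdiff hd2,
    integral_sub hd (hd1.const_mul 2), integral_const_mul, hzero, sub_zero] at h
  unfold stationary
  field_simp
  linarith

/-! ### Deterministic recursions -/

lemma antitone_of_convex_of_bddAbove {z : ℕ → ℝ}
    (hconv : ∀ d, z (d + 1) - z d ≤ z (d + 2) - z (d + 1)) (hbdd : BddAbove (Set.range z)) :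
    Antitone z := by
  refine antitone_nat_of_succ_le fun d => ?_
  by_contra! hpos
  have hmono : Monotone fun d => z (d + 1) - z d := monotone_nat_of_le_succ hconv
  have hgrow : ∀ n : ℕ, z d + n * (z (d + 1) - z d) ≤ z (d + n) := by
    intro n
    induction n with
    | zero => simp
    | succ n ih =>
      have hslope : z (d + 1) - z d ≤ z (d + n + 1) - z (d + n) := hmono (Nat.le_add_right d n)
      push_cast
      rw [← add_assoc]
      linarith
  obtain ⟨B, hB⟩ := hbdd
  obtain ⟨n, hn⟩ := exists_nat_gt ((B - z d) / (z (d + 1) - z d))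
  rw [div_lt_iff₀ (sub_pos.2 hpos)] at hn
  linarith [hgrow n, hB (Set.mem_range_self (d + n))]

lemma eventually_le_of_recursion {R : ℕ → ℝ} {α β : ℝ} (hα : 0 ≤ α)
    (hR : ∀ᶠ n : ℕ in atTop, R (n + 1) ≤ (1 - α / (n + 1)) * R n + β) :
    ∃ C, ∀ᶠ n : ℕ in atTop, R n ≤ β / (1 + α) * (n + 1) + C := by
  obtain ⟨n₀, hn₀⟩ := eventually_atTop.1
    (hR.and (tendsto_natCast_atTop_atTop.eventually_ge_atTop α))
  set γ := β / (1 + α) with hγ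
  have hβ : β = γ * (1 + α) := by rw [hγ]; field_simp
  set C := max 0 (R n₀ - γ * (n₀ + 1))
  refine ⟨C, eventually_atTop.2 ⟨n₀, fun n hn => ?_⟩⟩
  induction n, hn using Nat.le_induction with
  | base => linarith [le_max_right 0 (R n₀ - γ * (n₀ + 1))]
  | succ n hn ih =>
    obtain ⟨hRn, hαn⟩ := hn₀ n hn
    have hfactor : 0 ≤ 1 - α / (n + 1) := by
      rw [sub_nonneg, div_le_one (by positivity)]
      linarith
    have hdrop : 0 ≤ α / (n + 1) * C := by positivity
    calc R (n + 1) ≤ (1 - α / (n + 1)) * R n + β := hRn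
      _ ≤ (1 - α / (n + 1)) * (γ * (n + 1) + C) + β := by gcongr
      _ = γ * (n + 2) + C - α / (n + 1) * C := by rw [hβ]; field_simp; ring
      _ ≤ γ * ((n + 1 : ℕ) + 1) + C := by push_cast; linarith

lemma exists_pos_lt_of_continuous {φ : ℝ → ℝ} (hφ : Continuous φ) {γ : ℝ} (hγ : φ 0 < γ) :
    ∃ η > 0, φ η < γ :=
  ((eventually_mem_nhdsWithin (s := Set.Ioi 0)).and
    (((hφ.tendsto 0).mono_left nhdsWithin_le_nhds).eventually_lt_const hγ)).exists

lemma eventually_abs_div_lt_of_recursion {δ b M : ℕ → ℝ} {α β γ : ℝ} (hα : 0 ≤ α)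
    (hδ : ∀ n : ℕ, δ (n + 1) = (1 - α / (n + 1)) * δ n + b n + (M (n + 1) - M n))
    (hM : Tendsto (fun n : ℕ => M n / (n + 1)) atTop (𝓝 0))
    (hb : ∀ᶠ n in atTop, |b n| ≤ β) (hγ : β / (1 + α) < γ) :
    ∀ᶠ n : ℕ in atTop, |δ n / (n + 1)| < γ := by
  obtain ⟨η, hη, hηγ⟩ := exists_pos_lt_of_continuous
    (φ := fun η => (β + α * η) / (1 + α)) (by fun_prop) (by simpa using hγ)
  have hMabs : Tendsto (fun n : ℕ => |M n / (n + 1)|) atTop (𝓝 0) := by simpa using hM.abs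
  -- `δ - M` satisfies the recursion without the increments of `M`.
  obtain ⟨C, hC⟩ := eventually_le_of_recursion (R := fun n => |δ n - M n|) (β := β + α * η) hα <| by
    filter_upwards [hb, hMabs.eventually_lt_const hη,
      tendsto_natCast_atTop_atTop.eventually_ge_atTop α] with n hbn hMn hαn
    have hfactor : 0 ≤ 1 - α / (n + 1) := by
      rw [sub_nonneg, div_le_one (by positivity)]
      linarith
    calc |δ (n + 1) - M (n + 1)|
        = |(1 - α / (n + 1)) * (δ n - M n) + b n - α * (M n / (n + 1))| := by
          rw [hδ n]; congr 1; ring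
      _ ≤ |(1 - α / (n + 1)) * (δ n - M n)| + |b n| + |α * (M n / (n + 1))| :=
          (abs_sub _ _).trans (by gcongr; exact abs_add_le _ _)
      _ ≤ (1 - α / (n + 1)) * |δ n - M n| + β + α * η := by
          rw [abs_mul, abs_mul, abs_of_nonneg hfactor, abs_of_nonneg hα]
          gcongr
      _ = _ := by ring
  have hbound : Tendsto (fun n : ℕ => (β + α * η) / (1 + α) + C * (1 / ((n : ℝ) + 1))
      + |M n / (n + 1)|) atTop (𝓝 ((β + α * η) / (1 + α))) := by
    simpa using ((tendsto_one_div_add_atTop_nhds_zero_nat.const_mul C).const_add _).add hMabs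
  filter_upwards [hC, hbound.eventually_lt_const hηγ] with n hCn hn
  have hn1 : (0 : ℝ) < n + 1 := by positivity
  refine lt_of_le_of_lt ?_ hn
  calc |δ n / (n + 1)| = |(δ n - M n) / (n + 1) + M n / (n + 1)| := by congr 1; ring
    _ ≤ |δ n - M n| / (n + 1) + |M n / (n + 1)| := by
        rw [← abs_of_pos hn1, ← abs_div, abs_of_pos hn1]
        exact abs_add_le _ _
    _ ≤ ((β + α * η) / (1 + α) * (n + 1) + C) / (n + 1) + |M n / (n + 1)| := by gcongr
    _ = _ := by field_simp

lemma limsup_abs_div_le_of_recursion {δ p q e M : ℕ → ℝ} {α B : ℝ} (hα : 0 ≤ α)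
    (hpB : ∀ n, |p n / (n + 1)| ≤ B) (hqB : ∀ n, |q n / (n + 1)| ≤ B)
    (he : Tendsto e atTop (𝓝 0))
    (hM : Tendsto (fun n : ℕ => M n / (n + 1)) atTop (𝓝 0))
    (hδ : ∀ n : ℕ, δ (n + 1) = δ n + α * (p n + q n - 2 * δ n) / (n + 1) + e n
      + (M (n + 1) - M n)) :
    limsup (fun n : ℕ => |δ n / (n + 1)|) atTop
      ≤ α * (limsup (fun n : ℕ => |p n / (n + 1)|) atTop
        + limsup (fun n : ℕ => |q n / (n + 1)|) atTop) / (1 + 2 * α) := by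
  set zp := limsup (fun n : ℕ => |p n / (n + 1)|) atTop
  set zq := limsup (fun n : ℕ => |q n / (n + 1)|) atTop
  refine le_of_forall_gt_imp_ge_of_dense fun γ hγ => ?_
  obtain ⟨η, hη, hηγ⟩ := exists_pos_lt_of_continuous
    (φ := fun η => (α * ((zp + η) + (zq + η)) + η) / (1 + 2 * α)) (by fun_prop) (by simpa using hγ)
  have hp : ∀ᶠ n : ℕ in atTop, |p n / (n + 1)| < zp + η :=
    eventually_lt_of_limsup_lt (lt_add_of_pos_right _ hη) (isBoundedUnder_of ⟨B, hpB⟩)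
  have hq : ∀ᶠ n : ℕ in atTop, |q n / (n + 1)| < zq + η :=
    eventually_lt_of_limsup_lt (lt_add_of_pos_right _ hη) (isBoundedUnder_of ⟨B, hqB⟩)
  have hlt : ∀ᶠ n : ℕ in atTop, |δ n / (n + 1)| < γ := by
    refine eventually_abs_div_lt_of_recursion (α := 2 * α)
      (b := fun n => α * (p n / (n + 1) + q n / (n + 1)) + e n) (by positivity)
      (fun n => by rw [hδ]; ring) hM ?_ hηγ
    filter_upwards [hp, hq, he.abs.eventually_lt_const (by simpa using hη)] with n hpn hqn hen
    refine (abs_add_le _ _).trans (add_le_add ?_ hen.le)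
    rw [abs_mul, abs_of_nonneg hα]
    gcongr
    exact (abs_add_le _ _).trans (add_le_add hpn.le hqn.le)
  exact limsup_le_of_le (isBoundedUnder_of (r := (· ≥ ·)) ⟨0, fun n => abs_nonneg _⟩
    |>.isCoboundedUnder_le) (hlt.mono fun n => le_of_lt)

lemma tendsto_zero_of_recursion {r e M : ℕ → ℕ → ℝ} {B : ℝ} (hr0 : ∀ n, r 0 n = 0)
    (hrB : ∀ j n, |r j n / (n + 1)| ≤ B) (he : ∀ d, Tendsto (e d) atTop (𝓝 0))
    (hM : ∀ d, Tendsto (fun n : ℕ => M d n / (n + 1)) atTop (𝓝 0))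
    (hrec : ∀ d n : ℕ, r (d + 1) (n + 1) = r (d + 1) n
      + (d + 1) * (r d n + r (d + 2) n - 2 * r (d + 1) n) / (n + 1) + e d n
      + (M d (n + 1) - M d n)) (j : ℕ) :
    Tendsto (fun n : ℕ => r j n / (n + 1)) atTop (𝓝 0) := by
  set z : ℕ → ℝ := fun j => limsup (fun n : ℕ => |r j n / (n + 1)|) atTop with hz
  have hbdd (j : ℕ) : IsBoundedUnder (· ≤ ·) atTop fun n : ℕ => |r j n / (n + 1)| :=
    isBoundedUnder_of ⟨B, hrB j⟩
  have hz_nonneg (j : ℕ) : 0 ≤ z j :=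
    le_limsup_of_frequently_le (Frequently.of_forall fun n => abs_nonneg _) (hbdd j)
  have hz_le (j : ℕ) : z j ≤ B :=
    limsup_le_of_le (isBoundedUnder_of (r := (· ≥ ·)) ⟨0, fun n => abs_nonneg _⟩
      |>.isCoboundedUnder_le) (Eventually.of_forall (hrB j))
  have hconv (d : ℕ) : z (d + 1) - z d ≤ z (d + 2) - z (d + 1) := by
    have hd : (0 : ℝ) < d + 1 := by positivity
    have h : z (d + 1) ≤ (d + 1) * (z d + z (d + 2)) / (1 + 2 * (d + 1)) :=
      limsup_abs_div_le_of_recursion hd.le (hrB _) (hrB _) (he d) (hM d) (hrec d)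
    rw [le_div_iff₀ (by positivity)] at h
    refine le_of_mul_le_mul_left ?_ hd
    linarith [hz_nonneg (d + 1)]
  have hz_zero : z 0 = 0 := by simp [hz, hr0]
  have hz_nonpos : z j ≤ 0 := hz_zero ▸
    antitone_of_convex_of_bddAbove hconv ⟨B, by rintro _ ⟨j, rfl⟩; exact hz_le j⟩ j.zero_le
  refine (tendsto_zero_iff_abs_tendsto_zero _).2 (tendsto_order.2 ⟨fun a ha => ?_, fun a ha => ?_⟩)
  · exact Eventually.of_forall fun n => ha.trans_le (abs_nonneg _)
  · exact eventually_lt_of_limsup_lt (hz_nonpos.trans_lt ha) (hbdd j)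

/-! ### A strong law of large numbers for orthogonal random variables -/

section StrongLaw

variable {Ω : Type*} [MeasurableSpace Ω] {μ : Measure Ω}

lemma ae_tendsto_zero_of_summable_integral_norm {E : Type*} [NormedAddCommGroup E]
    {Z : ℕ → Ω → E} (hZ : ∀ k, Integrable (Z k) μ) (hsum : Summable fun k => ∫ ω, ‖Z k ω‖ ∂μ) :
    ∀ᵐ ω ∂μ, Tendsto (fun k => Z k ω) atTop (𝓝 0) := by
  have hmeas (k : ℕ) : AEMeasurable (fun ω => ‖Z k ω‖ₑ) μ := (hZ k).aestronglyMeasurable.enorm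
  have hfin : ∫⁻ ω, ∑' k, ‖Z k ω‖ₑ ∂μ ≠ ⊤ := by
    rw [lintegral_tsum hmeas]
    simp only [← ofReal_integral_norm_eq_lintegral_enorm (hZ _)]
    exact hsum.tsum_ofReal_ne_top
  filter_upwards [ae_lt_top' (AEMeasurable.tsum hmeas) hfin] with ω hω
  rw [tendsto_zero_iff_norm_tendsto_zero]
  simpa [Function.comp_def] using (ENNReal.tendsto_toReal ENNReal.zero_ne_top).comp
    (ENNReal.tendsto_atTop_zero_of_tsum_ne_top hω.ne)

lemma summable_const_div_add_one_sq (C : ℝ) : Summable fun k : ℕ => C / ((k : ℝ) + 1) ^ 2 := by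
  have h := (summable_nat_add_iff 1).2 (Real.summable_one_div_nat_pow.2 one_lt_two)
  simpa [div_eq_mul_inv] using h.mul_left C

lemma integral_sq_sum_of_orthogonal {ι : Type*} {D : ι → Ω → ℝ} (hD : ∀ i, MemLp (D i) 2 μ)
    (horth : Pairwise fun i j => ∫ ω, D i ω * D j ω ∂μ = 0) (s : Finset ι) :
    ∫ ω, (∑ i ∈ s, D i ω) ^ 2 ∂μ = ∑ i ∈ s, ∫ ω, D i ω ^ 2 ∂μ := by
  have hmul (i j : ι) : Integrable (fun ω => D i ω * D j ω) μ := (hD i).integrable_mul (hD j)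
  simp only [sq, Finset.sum_mul_sum]
  rw [integral_finsetSum _ fun i _ => integrable_finsetSum _ fun j _ => hmul i j]
  refine Finset.sum_congr rfl fun i hi => ?_
  rw [integral_finsetSum _ fun j _ => hmul i j]
  exact Finset.sum_eq_single_of_mem i hi fun j _ hji => horth hji.symm

/-- The quantity that controls the squared averages `((∑ i < n, a i) / (n + 1)) ^ 2` for all `n` in
the block `k ^ 2 ≤ n < (k + 1) ^ 2`: the square of the sum up to the start of the block plus the
Cauchy–Schwarz bound for the sum within the block, over the square of the length scale. -/
noncomputable def blockEnergy (a : ℕ → ℝ) (k : ℕ) : ℝ :=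
  ((∑ i ∈ Finset.range (k ^ 2), a i) ^ 2
    + (2 * k + 1) * ∑ i ∈ Finset.Ico (k ^ 2) ((k + 1) ^ 2), a i ^ 2) / (k + 1) ^ 4

lemma blockEnergy_nonneg (a : ℕ → ℝ) (k : ℕ) : 0 ≤ blockEnergy a k := by
  unfold blockEnergy
  positivity

lemma card_Ico_sq_succ_sq (k : ℕ) : (Finset.Ico (k ^ 2) ((k + 1) ^ 2)).card = 2 * k + 1 := by
  rw [Nat.card_Ico]
  exact Nat.sub_eq_of_eq_add (by ring)

lemma sq_sum_div_le_blockEnergy (a : ℕ → ℝ) (n : ℕ) :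
    ((∑ i ∈ Finset.range n, a i) / (n + 1)) ^ 2 ≤ 8 * blockEnergy a n.sqrt := by
  set k := n.sqrt
  have hkn : k ^ 2 ≤ n := Nat.sqrt_le' n
  have hnk : n < (k + 1) ^ 2 := Nat.lt_succ_sqrt' n
  have hblock : (∑ i ∈ Finset.Ico (k ^ 2) n, a i) ^ 2
      ≤ (2 * k + 1) * ∑ i ∈ Finset.Ico (k ^ 2) ((k + 1) ^ 2), a i ^ 2 := by
    have hsubset : Finset.Ico (k ^ 2) n ⊆ Finset.Ico (k ^ 2) ((k + 1) ^ 2) :=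
      Finset.Ico_subset_Ico_right hnk.le
    calc (∑ i ∈ Finset.Ico (k ^ 2) n, a i) ^ 2
        ≤ (Finset.Ico (k ^ 2) n).card * ∑ i ∈ Finset.Ico (k ^ 2) n, a i ^ 2 :=
          sq_sum_le_card_mul_sum_sq
      _ ≤ (Finset.Ico (k ^ 2) ((k + 1) ^ 2)).card
            * ∑ i ∈ Finset.Ico (k ^ 2) ((k + 1) ^ 2), a i ^ 2 := by gcongr
      _ = _ := by rw [card_Ico_sq_succ_sq]; push_cast; ring
  have hscale : ((k : ℝ) + 1) ^ 4 ≤ 4 * ((n : ℝ) + 1) ^ 2 := by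
    have hkn' : (k : ℝ) ^ 2 ≤ n := by exact_mod_cast hkn
    calc ((k : ℝ) + 1) ^ 4 = (((k : ℝ) + 1) ^ 2) ^ 2 := by ring
      _ ≤ (2 * ((n : ℝ) + 1)) ^ 2 := by
          gcongr
          linarith [sq_nonneg ((k : ℝ) - 1)]
      _ = _ := by ring
  rw [← Finset.sum_range_add_sum_Ico _ hkn, blockEnergy, div_pow, mul_div_assoc',
    div_le_div_iff₀ (by positivity) (by positivity)]
  calc _ ≤ (2 * ((∑ i ∈ Finset.range (k ^ 2), a i) ^ 2 + (∑ i ∈ Finset.Ico (k ^ 2) n, a i) ^ 2))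
        * (4 * ((n : ℝ) + 1) ^ 2) := by
        gcongr
        exact add_sq_le
    _ ≤ (2 * ((∑ i ∈ Finset.range (k ^ 2), a i) ^ 2
          + (2 * k + 1) * ∑ i ∈ Finset.Ico (k ^ 2) ((k + 1) ^ 2), a i ^ 2))
        * (4 * ((n : ℝ) + 1) ^ 2) := by gcongr
    _ = _ := by ring

section Orthogonal

variable {D : ℕ → Ω → ℝ} {C : ℝ}

lemma integrable_blockEnergy (hD : ∀ n, MemLp (D n) 2 μ) (k : ℕ) :
    Integrable (fun ω => blockEnergy (fun i => D i ω) k) μ :=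
  ((memLp_finsetSum _ fun i _ => hD i).integrable_sq.add
    ((integrable_finsetSum _ fun i _ => (hD i).integrable_sq).const_mul _)).div_const _

lemma integral_blockEnergy_le (hD : ∀ n, MemLp (D n) 2 μ) (hC : ∀ n, ∫ ω, D n ω ^ 2 ∂μ ≤ C)
    (horth : Pairwise fun i j => ∫ ω, D i ω * D j ω ∂μ = 0) (k : ℕ) :
    ∫ ω, blockEnergy (fun i => D i ω) k ∂μ ≤ 5 * C / (k + 1) ^ 2 := by
  have hC0 : 0 ≤ C := (integral_nonneg fun ω => sq_nonneg (D 0 ω)).trans (hC 0)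
  have hsum_le (s : Finset ℕ) : ∑ i ∈ s, ∫ ω, D i ω ^ 2 ∂μ ≤ s.card * C :=
    (Finset.sum_le_card_nsmul _ _ _ fun i _ => hC i).trans_eq (nsmul_eq_mul _ _)
  have hstart : MemLp (fun ω => ∑ i ∈ Finset.range (k ^ 2), D i ω) 2 μ :=
    memLp_finsetSum _ fun i _ => hD i
  have hblock : Integrable (fun ω => ∑ i ∈ Finset.Ico (k ^ 2) ((k + 1) ^ 2), D i ω ^ 2) μ :=
    integrable_finsetSum _ fun i _ => (hD i).integrable_sq
  simp only [blockEnergy]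
  rw [integral_div, integral_add hstart.integrable_sq (hblock.const_mul _), integral_const_mul,
    integral_sq_sum_of_orthogonal hD horth, integral_finsetSum _ fun i _ => (hD i).integrable_sq,
    div_le_div_iff₀ (by positivity) (by positivity)]
  calc _ ≤ ((Finset.range (k ^ 2)).card * C
          + (2 * k + 1) * ((Finset.Ico (k ^ 2) ((k + 1) ^ 2)).card * C)) * (k + 1 : ℝ) ^ 2 := by
        gcongr <;> exact hsum_le _
    _ = (5 * (k + 1 : ℝ) ^ 2 - (6 * k + 4)) * C * (k + 1) ^ 2 := by
        rw [Finset.card_range, card_Ico_sq_succ_sq]; push_cast; ring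
    _ ≤ 5 * (k + 1 : ℝ) ^ 2 * C * (k + 1) ^ 2 := by
        gcongr
        exact sub_le_self _ (by positivity)
    _ = _ := by ring

lemma tendsto_natSqrt_atTop : Tendsto Nat.sqrt atTop atTop :=
  tendsto_atTop.2 fun b => eventually_atTop.2 ⟨b * b, fun _ hn => Nat.le_sqrt.2 hn⟩

lemma ae_tendsto_sum_div_of_orthogonal (hD : ∀ n, MemLp (D n) 2 μ)
    (hC : ∀ n, ∫ ω, D n ω ^ 2 ∂μ ≤ C) (horth : Pairwise fun i j => ∫ ω, D i ω * D j ω ∂μ = 0) :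
    ∀ᵐ ω ∂μ, Tendsto (fun n : ℕ => (∑ i ∈ Finset.range n, D i ω) / (n + 1)) atTop (𝓝 0) := by
  have hsum : Summable fun k => ∫ ω, ‖blockEnergy (fun i => D i ω) k‖ ∂μ := by
    simp only [Real.norm_of_nonneg (blockEnergy_nonneg _ _)]
    exact (summable_const_div_add_one_sq (5 * C)).of_nonneg_of_le
      (fun k => integral_nonneg fun ω => blockEnergy_nonneg _ k)
      (integral_blockEnergy_le hD hC horth)
  filter_upwards [ae_tendsto_zero_of_summable_integral_norm (integrable_blockEnergy hD) hsum]
    with ω hω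
  have hsq : Tendsto (fun n : ℕ => ((∑ i ∈ Finset.range n, D i ω) / ((n : ℝ) + 1)) ^ 2) atTop
      (𝓝 0) :=
    squeeze_zero (fun n => sq_nonneg _) (sq_sum_div_le_blockEnergy _)
      (by simpa using (hω.comp tendsto_natSqrt_atTop).const_mul 8)
  exact (tendsto_zero_iff_abs_tendsto_zero _).2 <| by
    simpa only [Function.comp_def, Real.sqrt_sq_eq_abs, Real.sqrt_zero] using hsq.sqrt

end Orthogonal

end StrongLaw

/-! ### One step of the process -/

section Step

open scoped BigOperators

lemma expect_ite_mem {ι : Type*} [Fintype ι] [Nonempty ι] [DecidableEq ι] (s : Finset ι) (A B : ℝ) :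
    𝔼 i, (if i ∈ s then A else B) = B + s.card / Fintype.card ι * (A - B) := by
  have hsplit (i : ι) : (if i ∈ s then A else B) = B + if i ∈ s then A - B else 0 := by
    split_ifs <;> ring
  simp only [hsplit, Finset.expect_add_distrib, Fintype.expect_const]
  rw [Fintype.expect_eq_sum_div_card, Finset.sum_ite_mem, Finset.univ_inter, Finset.sum_const,
    nsmul_eq_mul]
  ring

lemma expect_fst {ι κ : Type*} [Fintype ι] [Fintype κ] [Nonempty κ] (f : ι → ℝ) :
    𝔼 p : ι × κ, f p.1 = 𝔼 i, f i := by
  simp only [← Finset.univ_product_univ, Finset.expect_product, Fintype.expect_const]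

lemma expect_snd {ι κ : Type*} [Fintype ι] [Fintype κ] [Nonempty ι] (f : κ → ℝ) :
    𝔼 p : ι × κ, f p.2 = 𝔼 j, f j := by
  simp only [← Finset.univ_product_univ, Finset.expect_product, Fintype.expect_const]

lemma expect_sub_expect_sq_le {ι : Type*} [Fintype ι] [Nonempty ι] (g : ι → ℝ) (c : ℝ) :
    𝔼 i, (g i - 𝔼 j, g j) ^ 2 ≤ 𝔼 i, (g i - c) ^ 2 := by
  set e := 𝔼 j, g j with he
  have hsplit (i : ι) :
      (g i - c) ^ 2 = (g i - e) ^ 2 + (2 * (e - c) * (g i - e) + (e - c) ^ 2) := by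
    ring
  simp only [hsplit, Finset.expect_add_distrib, ← Finset.mul_expect, Finset.expect_sub_distrib,
    Fintype.expect_const, ← he, sub_self, mul_zero, zero_add]
  exact le_add_of_nonneg_right (sq_nonneg _)

open scoped Classical

variable {m : ℕ} (G : SimpleGraph (Fin m)) (u v : Fin m)

/-- One step of the process: `u` is duplicated, then the edges of `v` are erased. -/
def step : SimpleGraph (Fin (m + 1)) := eraseProtected (duplicate G u) v

/-- The sum of `f (deg x)` over the vertices `x` of a graph. -/
noncomputable def degreeSum (f : ℕ → ℝ) : ℝ := ∑ x, f (G.degree x)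

/-- A vertex together with its neighbours. -/
noncomputable def closedNeighborFinset (x : Fin m) : Finset (Fin m) :=
  insert x (G.neighborFinset x)

lemma mem_closedNeighborFinset_comm {x y : Fin m} :
    x ∈ closedNeighborFinset G y ↔ y ∈ closedNeighborFinset G x := by
  simp only [closedNeighborFinset, Finset.mem_insert, SimpleGraph.mem_neighborFinset,
    G.adj_comm, eq_comm]

lemma card_closedNeighborFinset (x : Fin m) :
    (closedNeighborFinset G x).card = G.degree x + 1 := by
  rw [closedNeighborFinset, Finset.card_insert_of_notMem (by simp),
    SimpleGraph.card_neighborFinset_eq_degree]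

lemma step_adj_castSucc (x y : Fin m) :
    (step G u v).Adj x.castSucc y.castSucc ↔ G.Adj x y ∧ x ≠ v ∧ y ≠ v := by
  have hlast (z : Fin m) : Fin.last m ≠ z.castSucc := (Fin.castSucc_lt_last z).ne'
  have hmap : (G.map Fin.castSucc).Adj x.castSucc y.castSucc ↔ G.Adj x y :=
    SimpleGraph.map_adj_apply (f := Fin.castSuccEmb)
  simp +contextual [step, eraseProtected, duplicate, hmap, hlast, (hlast _).symm, eq_comm (a := v)]

lemma step_adj_last (x : Fin m) :
    (step G u v).Adj x.castSucc (Fin.last m) ↔ u ∈ closedNeighborFinset G x := by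
  have hlast (z : Fin m) : Fin.last m ≠ z.castSucc := (Fin.castSucc_lt_last z).ne'
  have hmap : ¬(G.map Fin.castSucc).Adj x.castSucc (Fin.last m) := by
    rintro ⟨-, a, b, -, -, hb⟩
    exact hlast b hb.symm
  simp [step, eraseProtected, duplicate, closedNeighborFinset, hmap, hlast, (hlast _).symm,
    G.adj_comm u, eq_comm (a := x)]

lemma degree_step_last : (step G u v).degree (Fin.last m) = G.degree u + 1 := by
  have h : (step G u v).neighborFinset (Fin.last m)
      = (closedNeighborFinset G u).map Fin.castSuccEmb := by
    ext y
    induction y using Fin.lastCases with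
    | last => simp [(Fin.castSucc_lt_last _).ne]
    | cast y =>
      rw [SimpleGraph.mem_neighborFinset, SimpleGraph.adj_comm, step_adj_last,
        mem_closedNeighborFinset_comm]
      simp
  rw [← SimpleGraph.card_neighborFinset_eq_degree, h, Finset.card_map, card_closedNeighborFinset]

/-- The number of neighbours of `x` after the edges at `v` have been erased. -/
noncomputable def erasedDegree (x : Fin m) : ℕ :=
  if v = x then 0 else if v ∈ G.neighborFinset x then G.degree x - 1 else G.degree x

lemma degree_step_castSucc (x : Fin m) :
    (step G u v).degree x.castSucc
      = erasedDegree G v x + if u ∈ closedNeighborFinset G x then 1 else 0 := by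
  have hold : ∑ y, (if G.Adj x y ∧ x ≠ v ∧ y ≠ v then 1 else 0) = erasedDegree G v x := by
    rw [← Finset.card_filter, erasedDegree]
    by_cases hx : v = x
    · simp [hx]
    · have h : Finset.univ.filter (fun y => G.Adj x y ∧ x ≠ v ∧ y ≠ v)
          = (G.neighborFinset x).erase v := by
        ext y
        simp [Ne.symm hx, and_comm]
      rw [h, Finset.card_erase_eq_ite, SimpleGraph.card_neighborFinset_eq_degree, if_neg hx]
  rw [← SimpleGraph.card_neighborFinset_eq_degree, SimpleGraph.neighborFinset_eq_filter,
    Finset.card_filter, Fin.sum_univ_castSucc]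
  simp only [step_adj_castSucc, step_adj_last, hold]

lemma degreeSum_bot (f : ℕ → ℝ) : degreeSum (⊥ : SimpleGraph (Fin m)) f = m * f 0 := by
  simp [degreeSum]

lemma degreeSum_const (c : ℝ) : degreeSum G (fun _ => c) = m * c := by simp [degreeSum]

lemma degreeSum_le_degreeSum {f g : ℕ → ℝ} (h : ∀ k, f k ≤ g k) : degreeSum G f ≤ degreeSum G g :=
  Finset.sum_le_sum fun _ _ => h _

lemma sq_degreeSum_le : degreeSum G Nat.cast ^ 2 ≤ m * degreeSum G fun k => (k : ℝ) ^ 2 := by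
  simpa [degreeSum] using
    sq_sum_le_card_mul_sum_sq (s := Finset.univ) (f := fun x => (G.degree x : ℝ))

section Mean

/-- The mean of `F` over the graphs that arise from `G` in one step, both choices being uniform. -/
noncomputable def stepMean (F : SimpleGraph (Fin (m + 1)) → ℝ) (G : SimpleGraph (Fin m)) : ℝ :=
  𝔼 p : Fin m × Fin m, F (step G p.1 p.2)

/-- The coefficient of order `1 / m` in the mean change of `f (deg x)` for a vertex `x` of degree
`D`, the new vertex included. For `D = 0` the truncated `D - 1` is harmless as it comes with the
factor `D`. -/
def generator (f : ℕ → ℝ) (D : ℕ) : ℝ :=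
  (D + 2) * f (D + 1) + D * f (D - 1) + f 0 - 2 * (D + 1) * f D

/-- The coefficient of order `1 / m ^ 2` in the mean change of `f (deg x)`, which accounts for both
choices affecting `x`. -/
def remainder (f : ℕ → ℝ) (D : ℕ) : ℝ :=
  (D + 1) * (f 1 - f 0 - (D + 1) * (f (D + 1) - f D) + D * (f D - f (D - 1)))

variable [NeZero m]

lemma expect_erasedDegree (g : ℕ → ℝ) (x : Fin m) :
    𝔼 v, g (erasedDegree G v x)
      = g (G.degree x) + (g 0 - g (G.degree x)) / m
        + G.degree x * (g (G.degree x - 1) - g (G.degree x)) / m := by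
  set D := G.degree x with hD
  have hsplit (v : Fin m) : g (erasedDegree G v x) = g D
      + (if v ∈ ({x} : Finset (Fin m)) then g 0 - g D else 0)
      + (if v ∈ G.neighborFinset x then g (D - 1) - g D else 0) := by
    by_cases hv : v = x
    · simp [erasedDegree, hv]
    · simp only [erasedDegree, hv, if_false, Finset.mem_singleton]
      split_ifs <;> ring
  simp only [hsplit, Finset.expect_add_distrib, Fintype.expect_const, expect_ite_mem,
    Finset.card_singleton, SimpleGraph.card_neighborFinset_eq_degree, Fintype.card_fin, ← hD]
  push_cast
  ring

lemma expect_add_closedNeighborFinset (f : ℕ → ℝ) (k : ℕ) (x : Fin m) :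
    𝔼 u, f (k + if u ∈ closedNeighborFinset G x then 1 else 0)
      = f k + (G.degree x + 1) / m * (f (k + 1) - f k) := by
  simp only [apply_ite, add_zero, expect_ite_mem, card_closedNeighborFinset, Fintype.card_fin]
  push_cast
  ring

lemma expect_degree_step_castSucc (f : ℕ → ℝ) (x : Fin m) :
    𝔼 p : Fin m × Fin m, f ((step G p.1 p.2).degree x.castSucc)
      = f (G.degree x) + (generator f (G.degree x) - f (G.degree x + 1)) / m
        + remainder f (G.degree x) / m ^ 2 := by
  have hpred : (G.degree x : ℝ) * f (G.degree x - 1 + 1) = G.degree x * f (G.degree x) := by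
    rcases Nat.eq_zero_or_pos (G.degree x) with h | h
    · simp [h]
    · rw [Nat.sub_add_cancel h]
  rw [← Finset.univ_product_univ, Finset.expect_product, Finset.expect_comm]
  simp only [degree_step_castSucc, expect_add_closedNeighborFinset]
  rw [expect_erasedDegree G (fun k => f k + (G.degree x + 1) / m * (f (k + 1) - f k)), generator,
    remainder]
  linear_combination (G.degree x + 1) / (m : ℝ) ^ 2 * hpred

lemma stepMean_degreeSum (f : ℕ → ℝ) :
    stepMean (degreeSum · f) G
      = degreeSum G f + degreeSum G (generator f) / m + degreeSum G (remainder f) / m ^ 2 := by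
  have hnew : 𝔼 p : Fin m × Fin m, f (G.degree p.1 + 1) = (∑ x, f (G.degree x + 1)) / m := by
    rw [expect_fst fun u => f (G.degree u + 1), Fintype.expect_eq_sum_div_card, Fintype.card_fin]
  simp only [stepMean, degreeSum, Fin.sum_univ_castSucc, degree_step_last,
    Finset.expect_add_distrib, Finset.expect_sum_comm, expect_degree_step_castSucc, hnew,
    Finset.sum_add_distrib, ← Finset.sum_div, Finset.sum_sub_distrib]
  ring

lemma stepMean_degreeSum_natCast :
    stepMean (degreeSum · Nat.cast) G = degreeSum G Nat.cast + 2 := by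
  have hgen : generator Nat.cast = fun _ => 2 := by
    ext (_ | D)
    · simp [generator]
    · simp only [generator, Nat.add_sub_cancel]
      push_cast
      ring
  have hrem : remainder Nat.cast = fun _ => 0 := by
    ext (_ | D) <;> simp [remainder]
  have hm : (m : ℝ) ≠ 0 := NeZero.ne _
  rw [stepMean_degreeSum, hgen, hrem, degreeSum_const, degreeSum_const]
  field_simp
  ring

lemma stepMean_degreeSum_sq_le :
    stepMean (degreeSum · fun k => (k : ℝ) ^ 2) G
      ≤ degreeSum G (fun k => (k : ℝ) ^ 2) + 6 * degreeSum G Nat.cast / m + 2 := by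
  have hgen : generator (fun k => (k : ℝ) ^ 2) = fun D : ℕ => 6 * (D : ℝ) + 2 := by
    ext (_ | D)
    · simp [generator]
    · simp only [generator, Nat.add_sub_cancel]
      push_cast
      ring
  have hrem : degreeSum G (remainder fun k => (k : ℝ) ^ 2) ≤ 0 := by
    refine Finset.sum_nonpos fun x _ => ?_
    have hD (D : ℕ) : remainder (fun k => (k : ℝ) ^ 2) D = -(4 * D * (D + 1)) := by
      rcases D with _ | D
      · simp [remainder]
      · simp only [remainder, Nat.add_sub_cancel]
        push_cast
        ring
    rw [hD, neg_nonpos]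
    positivity
  have hm : (m : ℝ) ≠ 0 := NeZero.ne _
  have hdegree : degreeSum G (fun D => 6 * (D : ℝ) + 2) = 6 * degreeSum G Nat.cast + 2 * m := by
    simp [degreeSum, Finset.sum_add_distrib, Finset.mul_sum, mul_comm]
  rw [stepMean_degreeSum, hgen, hdegree, add_div, mul_div_cancel_right₀ _ hm, ← add_assoc]
  exact add_le_of_nonpos_right (div_nonpos_of_nonpos_of_nonneg hrem (by positivity))

end Mean

/-- The function of the degree whose sum over the vertices is the number of vertices of degree
`j - 1` if `j > 0`, and the number of all vertices if `j = 0`. -/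
def degreeIndicator (j k : ℕ) : ℝ := if j = 0 ∨ j = k + 1 then 1 else 0

lemma degreeIndicator_nonneg (j k : ℕ) : 0 ≤ degreeIndicator j k := by
  unfold degreeIndicator
  positivity

lemma degreeIndicator_le_one (j k : ℕ) : degreeIndicator j k ≤ 1 := by
  unfold degreeIndicator
  split_ifs <;> norm_num

lemma degreeSum_degreeIndicator_zero : degreeSum G (degreeIndicator 0) = m := by
  simp [degreeSum, degreeIndicator]

lemma degreeSum_degreeIndicator_succ (d : ℕ) :
    degreeSum G (degreeIndicator (d + 1)) = degreeCount G d := by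
  simp [degreeSum, degreeIndicator, degreeCount, eq_comm]

lemma generator_degreeIndicator_succ (d D : ℕ) :
    generator (degreeIndicator (d + 1)) D = (d + 1) * (degreeIndicator d D
      + degreeIndicator (d + 2) D - 2 * degreeIndicator (d + 1) D) := by
  unfold generator degreeIndicator
  obtain rfl | rfl | rfl | hfar :
      D = d ∨ D = d + 1 ∨ d = D + 1 ∨ D ≠ d ∧ D ≠ d + 1 ∧ d ≠ D + 1 := by omega
  · rcases D with _ | D <;> [norm_num; grind]
  · rcases d with _ | d <;> [norm_num; grind]
  · rcases D with _ | D <;> [norm_num; grind]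
  · rcases D with _ | D <;> rcases d with _ | d <;> grind

lemma abs_remainder_degreeIndicator_succ_le (d D : ℕ) :
    |remainder (degreeIndicator (d + 1)) D| ≤ (2 * d + 3) * (D + 1) := by
  set f := degreeIndicator (d + 1)
  have hincr (k : ℕ) : |(k + 1) * (f (k + 1) - f k)| ≤ d + 1 := by
    simp only [f, degreeIndicator, Nat.add_eq_zero_iff, one_ne_zero, and_false, false_or,
      add_left_inj]
    rw [abs_mul, abs_of_pos (by positivity)]
    split_ifs <;> subst_vars <;> simp <;> linarith
  have hdecr : |D * (f D - f (D - 1))| ≤ d + 1 := by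
    rcases D with _ | D
    · simpa using by positivity
    · simpa using hincr D
  have hstart : |f 1 - f 0| ≤ 1 :=
    abs_sub_le_of_nonneg_of_le (degreeIndicator_nonneg _ _) (degreeIndicator_le_one _ _)
      (degreeIndicator_nonneg _ _) (degreeIndicator_le_one _ _)
  rw [remainder, abs_mul, abs_of_pos (by positivity), mul_comm]
  gcongr
  calc _ ≤ |f 1 - f 0| + |(D + 1) * (f (D + 1) - f D)| + |D * (f D - f (D - 1))| :=
        (abs_add_le _ _).trans (by gcongr; exact abs_sub _ _)
    _ ≤ 1 + (d + 1) + (d + 1) := by gcongr; exact hincr D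
    _ = _ := by ring

lemma abs_degreeSum_step_sub_le {f : ℕ → ℝ} (hf0 : ∀ k, 0 ≤ f k) (hf1 : ∀ k, f k ≤ 1) :
    |degreeSum (step G u v) f - degreeSum G f| ≤ G.degree u + G.degree v + 3 := by
  set s := closedNeighborFinset G u ∪ closedNeighborFinset G v
  have hx (x : Fin m) : |f ((step G u v).degree x.castSucc) - f (G.degree x)|
      ≤ if x ∈ s then 1 else 0 := by
    split_ifs with hxs
    · exact abs_sub_le_of_nonneg_of_le (hf0 _) (hf1 _) (hf0 _) (hf1 _)
    · rw [Finset.notMem_union, mem_closedNeighborFinset_comm,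
        mem_closedNeighborFinset_comm (x := x)] at hxs
      have hv : erasedDegree G v x = G.degree x := by
        obtain ⟨hne, hadj⟩ : v ≠ x ∧ v ∉ G.neighborFinset x := by
          simpa only [closedNeighborFinset, Finset.mem_insert, not_or] using hxs.2
        rw [erasedDegree, if_neg hne, if_neg hadj]
      simp [degree_step_castSucc, hv, hxs.1]
  have hs : (s.card : ℝ) ≤ G.degree u + G.degree v + 2 := by
    have h := Finset.card_union_le (closedNeighborFinset G u) (closedNeighborFinset G v)
    rw [card_closedNeighborFinset, card_closedNeighborFinset, add_add_add_comm] at h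
    exact_mod_cast h
  rw [degreeSum, Fin.sum_univ_castSucc, degreeSum, add_sub_right_comm, ← Finset.sum_sub_distrib]
  calc _ ≤ ∑ x, |f ((step G u v).degree x.castSucc) - f (G.degree x)|
        + |f ((step G u v).degree (Fin.last m))| :=
        (abs_add_le _ _).trans (by gcongr; exact Finset.abs_sum_le_sum_abs _ _)
    _ ≤ ∑ x, (if x ∈ s then (1 : ℝ) else 0) + 1 := by
        gcongr with x
        · exact hx x
        · rw [abs_of_nonneg (hf0 _)]; exact hf1 _
    _ = s.card + 1 := by simp
    _ ≤ _ := by linarith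

lemma stepMean_sq_degreeSum_sub_le [NeZero m] {f : ℕ → ℝ} (hf0 : ∀ k, 0 ≤ f k)
    (hf1 : ∀ k, f k ≤ 1) :
    stepMean (fun H => (degreeSum H f - degreeSum G f) ^ 2) G
      ≤ 6 * degreeSum G (fun k => (k : ℝ) ^ 2) / m + 27 := by
  have hsq (p : Fin m × Fin m) : (degreeSum (step G p.1 p.2) f - degreeSum G f) ^ 2
      ≤ 3 * (G.degree p.1 : ℝ) ^ 2 + 3 * (G.degree p.2 : ℝ) ^ 2 + 27 := by
    refine (sq_le_sq.2
      ((abs_degreeSum_step_sub_le G p.1 p.2 hf0 hf1).trans (le_abs_self _))).trans ?_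
    nlinarith [sq_nonneg ((G.degree p.1 : ℝ) - G.degree p.2), sq_nonneg ((G.degree p.1 : ℝ) - 3),
      sq_nonneg ((G.degree p.2 : ℝ) - 3)]
  refine (Finset.expect_le_expect fun p _ => hsq p).trans_eq ?_
  rw [Finset.expect_add_distrib, Finset.expect_add_distrib,
    expect_fst fun u => 3 * (G.degree u : ℝ) ^ 2, expect_snd fun v => 3 * (G.degree v : ℝ) ^ 2,
    Fintype.expect_const, Fintype.expect_eq_sum_div_card, Fintype.card_fin, ← Finset.mul_sum,
    degreeSum]
  ring

end Step

/-! ### Random choices -/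

section RandomChoice

open scoped BigOperators

variable {Ω : Type*} (U V : (n : ℕ) → Ω → Fin (n + 1))

/-- The two vertices that are chosen in step `n + 1`. -/
def choice (n : ℕ) (ω : Ω) : Fin (n + 1) × Fin (n + 1) := (U n ω, V n ω)

/-- The choices of the first `n` steps. -/
def past (n : ℕ) (ω : Ω) : (i : Finset.range n) → Fin (i + 1) × Fin (i + 1) :=
  fun i => choice U V i ω

/-- `Y` is a function of the choices of the first `n` steps. As there are only finitely many
outcomes of these, this replaces measurability with respect to the `σ`-algebra of the past. -/
def DependsOnPast {β : Type*} (n : ℕ) (Y : Ω → β) : Prop :=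
  ∀ ω ω', (∀ k < n, choice U V k ω = choice U V k ω') → Y ω = Y ω'

variable {U V} {n : ℕ} {β γ δ : Type*} {Y : Ω → β} {Z : Ω → γ}

namespace DependsOnPast

lemma mono {m : ℕ} (hY : DependsOnPast U V n Y) (hnm : n ≤ m) : DependsOnPast U V m Y :=
  fun ω ω' hω => hY ω ω' fun k hk => hω k (hk.trans_le hnm)

lemma comp (hY : DependsOnPast U V n Y) (g : β → γ) : DependsOnPast U V n fun ω => g (Y ω) :=
  fun ω ω' hω => congrArg g (hY ω ω' hω)

lemma comp₂ (hY : DependsOnPast U V n Y) (hZ : DependsOnPast U V n Z) (g : β → γ → δ) :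
    DependsOnPast U V n fun ω => g (Y ω) (Z ω) :=
  fun ω ω' hω => congrArg₂ g (hY ω ω' hω) (hZ ω ω' hω)

lemma exists_eq_comp_past [Nonempty β] (hY : DependsOnPast U V n Y) :
    ∃ φ : ((i : Finset.range n) → Fin (i + 1) × Fin (i + 1)) → β, Y = φ ∘ past U V n :=
  (Function.factorsThrough_iff Y).1 fun ω ω' hω =>
    hY ω ω' fun k hk => congrFun hω ⟨k, Finset.mem_range.2 hk⟩

end DependsOnPast

variable [MeasurableSpace Ω] {μ : Measure Ω}

namespace IsRandomChoice

lemma measurable_choice (h : IsRandomChoice μ U V) (n : ℕ) : Measurable (choice U V n) :=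
  (h.measurable_fst n).prodMk (h.measurable_snd n)

lemma measurable_past (h : IsRandomChoice μ U V) (n : ℕ) : Measurable (past U V n) :=
  measurable_pi_iff.2 fun i => h.measurable_choice i

lemma indepFun_past_choice (h : IsRandomChoice μ U V) (n : ℕ) :
    IndepFun (past U V n) (choice U V n) μ :=
  (h.indep_steps.indepFun_finset (Finset.range n) {n} (by simp) h.measurable_choice).comp
    measurable_id (measurable_pi_apply (⟨n, by simp⟩ : ({n} : Finset ℕ)))

lemma measureReal_choice_preimage (h : IsRandomChoice μ U V) (p : Fin (n + 1) × Fin (n + 1)) :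
    μ.real (choice U V n ⁻¹' {p}) = (((n : ℝ) + 1) ^ 2)⁻¹ := by
  have hpre : choice U V n ⁻¹' {p} = U n ⁻¹' {p.1} ∩ V n ⁻¹' {p.2} := by
    ext ω
    simp [choice, Prod.ext_iff]
  rw [hpre, measureReal_def, (h.indep_within_step n).measure_inter_preimage_eq_mul _ _
    (measurableSet_singleton _) (measurableSet_singleton _), h.uniform_fst, h.uniform_snd,
    ENNReal.toReal_mul, ENNReal.toReal_inv,
    ENNReal.toReal_add (ENNReal.natCast_ne_top n) ENNReal.one_ne_top]
  simp [sq]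

variable [IsProbabilityMeasure μ]

lemma memLp (h : IsRandomChoice μ U V) {Y : Ω → ℝ} (hY : DependsOnPast U V n Y) (p : ENNReal) :
    MemLp Y p μ := by
  obtain ⟨φ, rfl⟩ := hY.exists_eq_comp_past
  have := Measure.isProbabilityMeasure_map (h.measurable_past n).aemeasurable (μ := μ)
  exact MemLp.of_discrete.comp_of_map (h.measurable_past n).aemeasurable

lemma integrable (h : IsRandomChoice μ U V) {Y : Ω → ℝ} (hY : DependsOnPast U V n Y) :
    Integrable Y μ :=
  memLp_one_iff_integrable.1 (h.memLp hY 1)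

lemma integral_map_choice (h : IsRandomChoice μ U V) (g : Fin (n + 1) × Fin (n + 1) → ℝ) :
    ∫ p, g p ∂μ.map (choice U V n) = 𝔼 p, g p := by
  have hm := h.measurable_choice n
  have := Measure.isProbabilityMeasure_map hm.aemeasurable (μ := μ)
  have hmass (p) : (μ.map (choice U V n)).real {p} = (((n : ℝ) + 1) ^ 2)⁻¹ := by
    rw [map_measureReal_apply hm (measurableSet_singleton p), h.measureReal_choice_preimage]
  rw [integral_fintype .of_finite, Fintype.expect_eq_sum_div_card]
  simp only [hmass, smul_eq_mul, ← Finset.mul_sum, Fintype.card_prod, Fintype.card_fin]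
  push_cast
  ring

lemma integral_choice (h : IsRandomChoice μ U V) {f : Ω → Fin (n + 1) × Fin (n + 1) → ℝ}
    (hf : DependsOnPast U V n f) : ∫ ω, f ω (choice U V n ω) ∂μ = ∫ ω, 𝔼 p, f ω p ∂μ := by
  obtain ⟨φ, rfl⟩ := hf.exists_eq_comp_past
  have hpast := (h.measurable_past n).aemeasurable (μ := μ)
  have hchoice := (h.measurable_choice n).aemeasurable (μ := μ)
  have := Measure.isProbabilityMeasure_map hpast
  have := Measure.isProbabilityMeasure_map hchoice
  have hprod := (indepFun_iff_map_prod_eq_prod_map_map hpast hchoice).1 (h.indepFun_past_choice n)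
  calc ∫ ω, φ (past U V n ω) (choice U V n ω) ∂μ
    _ = ∫ q, φ q.1 q.2 ∂(μ.map (past U V n)).prod (μ.map (choice U V n)) := by
      rw [← hprod, integral_map (hpast.prodMk hchoice) .of_discrete]
    _ = ∫ c, ∫ p, φ c p ∂μ.map (choice U V n) ∂μ.map (past U V n) :=
      integral_prod _ .of_finite
    _ = ∫ ω, 𝔼 p, φ (past U V n ω) p ∂μ := by
      simp only [h.integral_map_choice]
      exact integral_map hpast .of_discrete

end IsRandomChoice

end RandomChoice

/-! ### The random graph process -/

section RandomGraph

open scoped BigOperators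

variable {Ω : Type*} (U V : (n : ℕ) → Ω → Fin (n + 1))

/-- The random graph after `n` steps. -/
def randomGraph (n : ℕ) (ω : Ω) : SimpleGraph (Fin (n + 1)) :=
  graph (fun k => U k ω) (fun k => V k ω) n

/-- The martingale difference of `degreeSum · f` in step `n + 1`: its value after the step minus the
conditional mean of that value given the graph before the step. -/
noncomputable def noise (f : ℕ → ℝ) (n : ℕ) (ω : Ω) : ℝ :=
  degreeSum (randomGraph U V (n + 1) ω) f - stepMean (degreeSum · f) (randomGraph U V n ω)

variable {U V}

lemma randomGraph_zero (ω : Ω) : randomGraph U V 0 ω = ⊥ := rfl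

lemma randomGraph_succ (n : ℕ) (ω : Ω) : randomGraph U V (n + 1) ω
    = step (randomGraph U V n ω) (choice U V n ω).1 (choice U V n ω).2 := rfl

lemma dependsOnPast_randomGraph (n : ℕ) : DependsOnPast U V n (randomGraph U V n) := by
  induction n with
  | zero => exact fun _ _ _ => rfl
  | succ n ih =>
    intro ω ω' hω
    rw [randomGraph_succ, randomGraph_succ, hω n n.lt_succ_self,
      ih ω ω' fun k hk => hω k (hk.trans n.lt_succ_self)]

lemma dependsOnPast_degreeSum (f : ℕ → ℝ) (n : ℕ) :
    DependsOnPast U V n fun ω => degreeSum (randomGraph U V n ω) f :=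
  (dependsOnPast_randomGraph n).comp (degreeSum · f)

lemma dependsOnPast_noise (f : ℕ → ℝ) (n : ℕ) : DependsOnPast U V (n + 1) (noise U V f n) :=
  (dependsOnPast_degreeSum f (n + 1)).comp₂
    (((dependsOnPast_randomGraph n).comp (stepMean (degreeSum · f))).mono n.le_succ) (· - ·)

lemma degreeSum_degreeIndicator_randomGraph_succ (d n : ℕ) (ω : Ω) :
    degreeSum (randomGraph U V (n + 1) ω) (degreeIndicator (d + 1))
      = degreeSum (randomGraph U V n ω) (degreeIndicator (d + 1))
        + (d + 1) * (degreeSum (randomGraph U V n ω) (degreeIndicator d)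
          + degreeSum (randomGraph U V n ω) (degreeIndicator (d + 2))
          - 2 * degreeSum (randomGraph U V n ω) (degreeIndicator (d + 1))) / (n + 1)
        + degreeSum (randomGraph U V n ω) (remainder (degreeIndicator (d + 1))) / (n + 1) ^ 2
        + noise U V (degreeIndicator (d + 1)) n ω := by
  set G := randomGraph U V n ω with hG
  have hgen : degreeSum G (generator (degreeIndicator (d + 1)))
      = (d + 1) * (degreeSum G (degreeIndicator d) + degreeSum G (degreeIndicator (d + 2))
        - 2 * degreeSum G (degreeIndicator (d + 1))) := by
    simp only [degreeSum, generator_degreeIndicator_succ, ← Finset.mul_sum,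
      Finset.sum_sub_distrib, Finset.sum_add_distrib]
  rw [noise, ← hG, stepMean_degreeSum, hgen]
  push_cast
  ring

lemma abs_degreeSum_remainder_degreeIndicator_succ_le {m : ℕ} (G : SimpleGraph (Fin m)) (d : ℕ) :
    |degreeSum G (remainder (degreeIndicator (d + 1)))|
      ≤ (2 * d + 3) * (degreeSum G Nat.cast + m) := by
  refine (Finset.abs_sum_le_sum_abs _ _).trans ((Finset.sum_le_sum fun x _ =>
    abs_remainder_degreeIndicator_succ_le d _).trans_eq ?_)
  simp [degreeSum, ← Finset.mul_sum, Finset.sum_add_distrib]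

lemma degreeSum_degreeIndicator_div_mem_Icc {m : ℕ} (G : SimpleGraph (Fin m)) (j : ℕ) :
    degreeSum G (degreeIndicator j) / m ∈ Set.Icc 0 1 := by
  refine ⟨div_nonneg (Finset.sum_nonneg fun x _ => degreeIndicator_nonneg j _) m.cast_nonneg,
    div_le_one_of_le₀ ?_ m.cast_nonneg⟩
  calc degreeSum G (degreeIndicator j) ≤ degreeSum G fun _ => 1 :=
        degreeSum_le_degreeSum G (degreeIndicator_le_one j)
    _ = m := by rw [degreeSum_const, mul_one]

lemma tendsto_degreeSum_remainder_div {ω : Ω} (hS : Tendsto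
    (fun n : ℕ => degreeSum (randomGraph U V n ω) Nat.cast / ((n : ℝ) + 1) ^ 2) atTop (𝓝 0))
    (d : ℕ) : Tendsto (fun n : ℕ => degreeSum (randomGraph U V n ω)
      (remainder (degreeIndicator (d + 1))) / ((n : ℝ) + 1) ^ 2) atTop (𝓝 0) := by
  have hbound : Tendsto (fun n : ℕ => (2 * (d : ℝ) + 3)
      * (degreeSum (randomGraph U V n ω) Nat.cast / ((n : ℝ) + 1) ^ 2 + 1 / ((n : ℝ) + 1)))
      atTop (𝓝 0) := by
    simpa using (hS.add tendsto_one_div_add_atTop_nhds_zero_nat).const_mul (2 * (d : ℝ) + 3)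
  refine squeeze_zero_norm (fun n => ?_) hbound
  have h := abs_degreeSum_remainder_degreeIndicator_succ_le (randomGraph U V n ω) d
  push_cast at h
  rw [norm_div, Real.norm_eq_abs, norm_pow, Real.norm_of_nonneg (by positivity),
    div_le_iff₀ (by positivity)]
  refine h.trans_eq ?_
  field_simp

variable [MeasurableSpace Ω] {μ : Measure Ω} [IsProbabilityMeasure μ]

namespace IsRandomChoice

lemma integrable_degreeSum (h : IsRandomChoice μ U V) (f : ℕ → ℝ) (n : ℕ) :
    Integrable (fun ω => degreeSum (randomGraph U V n ω) f) μ :=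
  h.integrable (dependsOnPast_degreeSum f n)

lemma integral_randomGraph_succ (h : IsRandomChoice μ U V) {n : ℕ}
    {F : Ω → SimpleGraph (Fin (n + 2)) → ℝ} (hF : DependsOnPast U V n F) :
    ∫ ω, F ω (randomGraph U V (n + 1) ω) ∂μ = ∫ ω, stepMean (F ω) (randomGraph U V n ω) ∂μ :=
  h.integral_choice (f := fun ω p => F ω (step (randomGraph U V n ω) p.1 p.2))
    (hF.comp₂ (dependsOnPast_randomGraph n) fun F G (p : _ × _) => F (step G p.1 p.2))

lemma integral_degreeSum_succ (h : IsRandomChoice μ U V) (f : ℕ → ℝ) (n : ℕ) :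
    ∫ ω, degreeSum (randomGraph U V (n + 1) ω) f ∂μ
      = ∫ ω, stepMean (degreeSum · f) (randomGraph U V n ω) ∂μ :=
  h.integral_randomGraph_succ (F := fun _ => (degreeSum · f)) fun _ _ _ => rfl

lemma integral_degreeSum_natCast (h : IsRandomChoice μ U V) (n : ℕ) :
    ∫ ω, degreeSum (randomGraph U V n ω) Nat.cast ∂μ = 2 * n := by
  induction n with
  | zero => simp [randomGraph_zero, degreeSum_bot]
  | succ n ih =>
    rw [h.integral_degreeSum_succ]
    simp only [stepMean_degreeSum_natCast]
    rw [integral_add (h.integrable_degreeSum _ n) (integrable_const _), ih]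
    rw [integral_const, probReal_univ, one_smul]
    push_cast
    ring

lemma integral_degreeSum_sq_le (h : IsRandomChoice μ U V) (n : ℕ) :
    ∫ ω, degreeSum (randomGraph U V n ω) (fun k => (k : ℝ) ^ 2) ∂μ ≤ 14 * n := by
  induction n with
  | zero => simp [randomGraph_zero, degreeSum_bot]
  | succ n ih =>
    have hsq := h.integrable_degreeSum (fun k => (k : ℝ) ^ 2) n
    have hlin := ((h.integrable_degreeSum Nat.cast n).const_mul 6).div_const ((n + 1 : ℕ) : ℝ)
    calc ∫ ω, degreeSum (randomGraph U V (n + 1) ω) (fun k => (k : ℝ) ^ 2) ∂μ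
      _ = ∫ ω, stepMean (degreeSum · fun k => (k : ℝ) ^ 2) (randomGraph U V n ω) ∂μ :=
        h.integral_degreeSum_succ _ n
      _ ≤ ∫ ω, (degreeSum (randomGraph U V n ω) (fun k => (k : ℝ) ^ 2)
          + 6 * degreeSum (randomGraph U V n ω) Nat.cast / (n + 1 : ℕ) + 2) ∂μ :=
        integral_mono (h.integrable ((dependsOnPast_randomGraph n).comp _))
          ((hsq.add hlin).add (integrable_const _)) fun ω => stepMean_degreeSum_sq_le _
      _ = ∫ ω, degreeSum (randomGraph U V n ω) (fun k => (k : ℝ) ^ 2) ∂μ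
          + 12 * (n / (n + 1)) + 2 := by
        rw [integral_add (by exact hsq.add hlin) (integrable_const _), integral_add hsq hlin,
          integral_div, integral_const_mul, h.integral_degreeSum_natCast]
        rw [integral_const, probReal_univ, one_smul]
        push_cast
        ring
      _ ≤ 14 * n + 12 * 1 + 2 := by
        gcongr
        exact div_le_one_of_le₀ (by linarith) (by positivity)
      _ = 14 * (n + 1 : ℕ) := by push_cast; ring

lemma integral_degreeSum_div_sq_le (h : IsRandomChoice μ U V) (n : ℕ) :
    ∫ ω, (degreeSum (randomGraph U V n ω) Nat.cast / ((n : ℝ) + 1) ^ 2) ^ 2 ∂μ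
      ≤ 14 / ((n : ℝ) + 1) ^ 2 := by
  calc ∫ ω, (degreeSum (randomGraph U V n ω) Nat.cast / ((n : ℝ) + 1) ^ 2) ^ 2 ∂μ
    _ ≤ ∫ ω, degreeSum (randomGraph U V n ω) (fun k => (k : ℝ) ^ 2) / ((n : ℝ) + 1) ^ 3 ∂μ := by
      refine integral_mono (h.integrable ((dependsOnPast_randomGraph n).comp fun G =>
        (degreeSum G Nat.cast / ((n : ℝ) + 1) ^ 2) ^ 2))
        ((h.integrable_degreeSum _ n).div_const _) fun ω => ?_
      have hCS := sq_degreeSum_le (randomGraph U V n ω)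
      push_cast at hCS
      beta_reduce
      rw [div_pow, div_le_div_iff₀ (by positivity) (by positivity)]
      calc _ ≤ _ := mul_le_mul_of_nonneg_right hCS (by positivity)
        _ = _ := by ring
    _ ≤ 14 * ((n : ℝ) + 1) / ((n : ℝ) + 1) ^ 3 := by
      rw [integral_div]
      gcongr
      linarith [h.integral_degreeSum_sq_le n]
    _ = _ := by field_simp

lemma ae_tendsto_degreeSum_natCast_div_sq (h : IsRandomChoice μ U V) :
    ∀ᵐ ω ∂μ, Tendsto (fun n : ℕ => degreeSum (randomGraph U V n ω) Nat.cast / ((n : ℝ) + 1) ^ 2)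
      atTop (𝓝 0) := by
  have hsum : Summable fun n : ℕ =>
      ∫ ω, ‖(degreeSum (randomGraph U V n ω) Nat.cast / ((n : ℝ) + 1) ^ 2) ^ 2‖ ∂μ := by
    simp only [norm_pow, Real.norm_eq_abs, sq_abs]
    exact .of_nonneg_of_le (fun n => integral_nonneg fun ω => sq_nonneg _)
      h.integral_degreeSum_div_sq_le (summable_const_div_add_one_sq _)
  filter_upwards [ae_tendsto_zero_of_summable_integral_norm (fun n => h.integrable
    ((dependsOnPast_degreeSum Nat.cast n).comp fun y => (y / ((n : ℝ) + 1) ^ 2) ^ 2)) hsum]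
    with ω hω
  refine (tendsto_zero_iff_abs_tendsto_zero _).2 ?_
  simpa only [Real.sqrt_sq_eq_abs, Real.sqrt_zero, Function.comp_def] using hω.sqrt

lemma integral_mul_noise (h : IsRandomChoice μ U V) {n : ℕ} {Y : Ω → ℝ}
    (hY : DependsOnPast U V n Y) (f : ℕ → ℝ) : ∫ ω, Y ω * noise U V f n ω ∂μ = 0 := by
  refine (h.integral_randomGraph_succ (hY.comp₂ (dependsOnPast_randomGraph n) fun y G H =>
    y * (degreeSum H f - stepMean (degreeSum · f) G))).trans ?_
  simp only [stepMean, ← Finset.mul_expect, Finset.expect_sub_distrib, Fintype.expect_const,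
    sub_self, mul_zero, integral_zero]

lemma pairwise_integral_noise_mul_noise (h : IsRandomChoice μ U V) (f : ℕ → ℝ) :
    Pairwise fun i j => ∫ ω, noise U V f i ω * noise U V f j ω ∂μ = 0 := by
  intro i j hij
  rcases hij.lt_or_gt with hlt | hlt
  · exact h.integral_mul_noise ((dependsOnPast_noise f i).mono hlt) f
  · simp only [mul_comm (noise U V f i _)]
    exact h.integral_mul_noise ((dependsOnPast_noise f j).mono hlt) f

lemma integral_noise_sq_le (h : IsRandomChoice μ U V) {f : ℕ → ℝ} (hf0 : ∀ k, 0 ≤ f k)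
    (hf1 : ∀ k, f k ≤ 1) (n : ℕ) : ∫ ω, noise U V f n ω ^ 2 ∂μ ≤ 111 := by
  have hsq := ((h.integrable_degreeSum (fun k => (k : ℝ) ^ 2) n).const_mul 6).div_const
    ((n + 1 : ℕ) : ℝ)
  calc ∫ ω, noise U V f n ω ^ 2 ∂μ
    _ = ∫ ω, stepMean (fun H => (degreeSum H f
        - stepMean (degreeSum · f) (randomGraph U V n ω)) ^ 2) (randomGraph U V n ω) ∂μ :=
      h.integral_randomGraph_succ ((dependsOnPast_randomGraph n).comp fun G H =>
        (degreeSum H f - stepMean (degreeSum · f) G) ^ 2)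
    _ ≤ ∫ ω, (6 * degreeSum (randomGraph U V n ω) (fun k => (k : ℝ) ^ 2) / (n + 1 : ℕ) + 27) ∂μ :=
      integral_mono (h.integrable ((dependsOnPast_randomGraph n).comp fun G =>
        stepMean (fun H => (degreeSum H f - stepMean (degreeSum · f) G) ^ 2) G))
        (hsq.add (integrable_const _)) fun ω => (expect_sub_expect_sq_le _ _).trans
          (stepMean_sq_degreeSum_sub_le _ hf0 hf1)
    _ = 6 * (∫ ω, degreeSum (randomGraph U V n ω) (fun k => (k : ℝ) ^ 2) ∂μ) / (n + 1) + 27 := by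
      rw [integral_add hsq (integrable_const _), integral_div, integral_const_mul]
      simp
    _ ≤ 84 + 27 := by
      gcongr
      rw [div_le_iff₀ (by positivity)]
      linarith [h.integral_degreeSum_sq_le n]
    _ = 111 := by norm_num

lemma ae_tendsto_sum_noise_div (h : IsRandomChoice μ U V) {f : ℕ → ℝ} (hf0 : ∀ k, 0 ≤ f k)
    (hf1 : ∀ k, f k ≤ 1) :
    ∀ᵐ ω ∂μ, Tendsto (fun n : ℕ => (∑ k ∈ Finset.range n, noise U V f k ω) / ((n : ℝ) + 1)) atTop
      (𝓝 0) :=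
  ae_tendsto_sum_div_of_orthogonal (fun n => h.memLp (dependsOnPast_noise f n) 2)
    (h.integral_noise_sq_le hf0 hf1) (h.pairwise_integral_noise_mul_noise f)

lemma ae_tendsto_degreeSum_degreeIndicator_div (h : IsRandomChoice μ U V) :
    ∀ᵐ ω ∂μ, ∀ j, Tendsto
      (fun n : ℕ => degreeSum (randomGraph U V n ω) (degreeIndicator j) / ((n : ℝ) + 1)) atTop
      (𝓝 (stationary j)) := by
  have hnoise (d : ℕ) := h.ae_tendsto_sum_noise_div (degreeIndicator_nonneg (d + 1))
    (degreeIndicator_le_one (d + 1))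
  filter_upwards [ae_all_iff.2 hnoise, h.ae_tendsto_degreeSum_natCast_div_sq] with ω hM hS j
  set N : ℕ → ℕ → ℝ := fun j n => degreeSum (randomGraph U V n ω) (degreeIndicator j)
  have hdev (j n : ℕ) : (N j n - stationary j * (n + 1)) / ((n : ℝ) + 1)
      = N j n / ((n : ℝ) + 1) - stationary j := by field_simp
  refine tendsto_sub_nhds_zero_iff.1 ((tendsto_congr (hdev j)).1 ?_)
  refine tendsto_zero_of_recursion (r := fun j n => N j n - stationary j * (n + 1)) (B := 1)
    (e := fun d n => degreeSum (randomGraph U V n ω) (remainder (degreeIndicator (d + 1)))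
      / ((n : ℝ) + 1) ^ 2)
    (M := fun d n => ∑ k ∈ Finset.range n, noise U V (degreeIndicator (d + 1)) k ω)
    (fun n => ?_) (fun j n => ?_) (tendsto_degreeSum_remainder_div hS) hM (fun d n => ?_) j
  · simp [N, degreeSum_degreeIndicator_zero, stationary_zero]
  · obtain ⟨h0, h1⟩ := degreeSum_degreeIndicator_div_mem_Icc (randomGraph U V n ω) j
    push_cast at h0 h1
    rw [hdev]
    exact abs_sub_le_of_nonneg_of_le h0 h1 (stationary_pos j).le (stationary_le_one j)
  · have hstationary : (2 * d + 3) * stationary (d + 1)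
        = (d + 1) * (stationary d + stationary (d + 2)) := by
      rw [stationary_succ]
      field_simp
    simp only [N, degreeSum_degreeIndicator_randomGraph_succ, Finset.sum_range_succ]
    push_cast
    field_simp
    linear_combination -((n : ℝ) + 1) ^ 2 * hstationary

end IsRandomChoice

end RandomGraph

end DuplicationDeletion

theorem theorem1 :
    ∃ c : ℕ → ℝ,
      (∀ d : ℕ, 0 < c d) ∧
      c 0 = (1 + c 1) / 3 ∧
      (∀ d : ℕ, 1 ≤ d →
        c d = ((d : ℝ) + 1) / (2 * (d : ℝ) + 3) * (c (d - 1) + c (d + 1))) ∧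
      ∀ (Ω : Type*) [MeasurableSpace Ω] (μ : Measure Ω) [IsProbabilityMeasure μ]
        (U V : (n : ℕ) → Ω → Fin (n + 1)),
        DuplicationDeletion.IsRandomChoice μ U V →
        ∀ d : ℕ, ∀ᵐ ω ∂μ,
          Tendsto (fun n : ℕ => (DuplicationDeletion.X U V n d ω : ℝ) / ((n : ℝ) + 1))
            atTop (𝓝 (c d)) := by
  refine ⟨fun d => DuplicationDeletion.stationary (d + 1),
    fun d => DuplicationDeletion.stationary_pos _, ?_, fun d hd => ?_, fun Ω _ μ _ U V h d => ?_⟩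
  · have hzero := DuplicationDeletion.stationary_succ 0
    rw [DuplicationDeletion.stationary_zero] at hzero
    norm_num at hzero ⊢
    linarith
  · obtain ⟨k, rfl⟩ := Nat.exists_eq_add_of_le' hd
    exact DuplicationDeletion.stationary_succ (k + 1)
  · filter_upwards [h.ae_tendsto_degreeSum_degreeIndicator_div] with ω hω
    simpa only [DuplicationDeletion.degreeSum_degreeIndicator_succ] using! hω (d + 1)
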